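/- Let $p$ be a prime, let $v$ be the valuation on $\mathbb{C}_p$ with $v(p)=1$, and normalize $-\log|\cdot|$ so that $-\log|x| = v(x)$ for $x\in\mathbb{C}_p$ (in particular $-\log|p|=1$). For a real number $r>0$ and an integer $N_0$, let $N_p(r,N_0)$ be the smallest positive integer $N$ such that $r(n-N_0) > \lfloor \log_p n\rfloor$ for all integers $n\ge N$. Let $r>0$, and let $A=\{t : 0<v(t)<r\}$ be the open annulus of length $r$ over $\mathbb{C}_p$. Its analytic functions are the Laurent series $\sum_{i\in\mathbb{Z}}a_it^i$ with $a_i\in\mathbb{C}_p$ and $v(a_i)+is\to\infty$ as $i\to\pm\infty$ for every $s\in(0,r)$. Its skeleton is the open interval $e=(0,r)$, where $s\in e$ stands for the norm $\|\cdot\|_s$ with $-\log\|\sum a_it^i\|_s=\min_i\,(v(a_i)+is)$. An analytic differential form on $A$ is uniquely of the form $\omega=h\,dt/t$ with $h$ analytic on $A$; it is measured by the metric with $\|dt/t\|=1$, that is, $\|\omega\|$ at $s\in e$ is $\|h\|_s$. (If $A$ is the inverse image of an open edge of a skeleton of a smooth proper connected curve $X$ over $\mathbb{C}_p$, coming from a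 semistable model of $X$, this is the model metric on $\Omega^1_{X/\mathbb{C}_p}$ attached to the relative dualizing sheaf.) Let $\omega\neq 0$ be an analytic differential form on $A$ that is exact, $\omega=df$ with $f$ analytic on $A$, and put $F=-\log|f|$ and $G=-\log\|\omega\|$, regarded as functions on $e$. Let $x$ be one of the two endpoints of $e$, let $y$ be the other one, and assume that $G$ is affine-linear near $x$ with a slope $N_0\in\mathbb{Z}$ at $x$ in the direction of $y$. (This holds, for some $N_0$, whenever $\omega$ is the restriction to $A$ of a nonzero global differential $\omega\in H^0(X,\Omega^1_{X/\mathbb{C}_p})$ on a curve $X$ as above.) Let $a\in(0,r)$, and let $z$ be the point of $e$ at distance $a$ from $y$ and $r-a$ from $x$. Then $F$ has an integer slope at $z$ in the direction of $y$, and this slope is at most $N_p(r-a,N_0)$. -/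

import Mathlib

open Filter Topology

noncomputable section

/-- Analytic functions on the open annulus `{t : 0 < v(t) < r}` over `ℂ_[p]`, where `v` is the
valuation with `v(p) = 1`, so that `‖x‖ = p ^ (-v(x))`. In terms of the inner radius `ρ = p ^ (-r)`
this is the open annulus `{t : ρ < ‖t‖ < 1}` of logarithmic modulus (length) `r`. Such a function
is an infinite-tailed Laurent series `∑ aᵢ tⁱ` with `‖aᵢ‖ τⁱ → 0` as `i → ±∞` for
every radius `τ = p ^ (-s)` between `ρ` and `1`, that is, for every `s` in `(0, r)`. -/
@[ext]
structure AnnulusFunction (p : ℕ) [Fact p.Prime] (r : ℝ) where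
  /-- the Laurent coefficients -/
  coeff : ℤ → ℂ_[p]
  tendsto_zero : ∀ s ∈ Set.Ioo (0 : ℝ) r,
    Tendsto (fun i : ℤ => ‖coeff i‖ * ((p : ℝ) ^ (-s)) ^ i) cofinite (𝓝 0)

/-- The canonical bundle of the annulus is trivialised by the invariant differential `dt / t`: an
analytic differential form on the annulus is uniquely `h(t) dt / t` with `h` analytic. -/
@[ext]
structure AnnulusForm (p : ℕ) [Fact p.Prime] (r : ℝ) where
  /-- the function `h` in `h dt / t` -/
  h : AnnulusFunction p r

/-- The ends of the annulus, i.e. the endpoints of its skeleton: `outer` is the end `‖t‖ → 1`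
(where `v(t) → 0`), and `inner` is the end `‖t‖ → ρ` (where `v(t) → r`). -/
inductive AnnulusEnd where
  | outer
  | inner

/-- The coordinate `v(t)` in `(0, r)` of the skeleton point at distance `d` from an end. -/
def AnnulusEnd.coord (x : AnnulusEnd) (r d : ℝ) : ℝ :=
  match x with
  | .outer => d
  | .inner => r - d

section

variable {p : ℕ} [Fact p.Prime] {r : ℝ}

instance : Zero (AnnulusFunction p r) := ⟨⟨fun _ => 0, fun s _ => by simp⟩⟩

instance : Zero (AnnulusForm p r) := ⟨⟨0⟩⟩

/-- The exterior derivative `d (∑ aᵢ tⁱ) = (∑ i aᵢ tⁱ) dt / t`. -/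
def AnnulusFunction.d (f : AnnulusFunction p r) : AnnulusForm p r where
  h :=
    { coeff := fun i => (i : ℂ_[p]) * f.coeff i
      tendsto_zero := fun s hs => by
        refine squeeze_zero (fun i => by positivity) (fun i => ?_) (f.tendsto_zero s hs)
        rw [norm_mul, mul_assoc]
        exact mul_le_of_le_one_left (by positivity)
          (IsUltrametricDist.norm_intCast_le_one ℂ_[p] i) }

/-- The value `|f(σ(s))| = maxᵢ ‖aᵢ‖ τⁱ`, `τ = p ^ (-s)`, of an analytic function at the point
`σ(s)` with `v(t) = s` of the skeleton of the annulus (the Gauss point of radius `τ`). -/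
def AnnulusFunction.absAt (f : AnnulusFunction p r) (s : ℝ) : ℝ :=
  ⨆ i : ℤ, ‖f.coeff i‖ * ((p : ℝ) ^ (-s)) ^ i

/-- The norm `‖ω(σ(s))‖` of a differential form at the skeleton point `σ(s)`, for the metric on the
canonical bundle in which the generator `dt / t` has norm `1`. If the annulus is the inverse image
of a node under the reduction map of a semistable model of a curve, this is the restriction of the
model metric, because `dt / t` then generates the relative dualizing sheaf at the node. -/
def AnnulusForm.normAt (ω : AnnulusForm p r) (s : ℝ) : ℝ := ω.h.absAt s

/-- `F = -log |f|` on the open edge `(0, r)`, as a function of the distance from the end `x`. The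
logarithm is normalised, like the length of the edge, so that `-log |p| = v(p) = 1`. -/
def AnnulusFunction.trop (f : AnnulusFunction p r) (x : AnnulusEnd) (d : ℝ) : ℝ :=
  -Real.logb p (f.absAt (x.coord r d))

/-- `G = -log ‖ω‖` on the open edge `(0, r)`, as a function of the distance from the end `x`. -/
def AnnulusForm.trop (ω : AnnulusForm p r) (x : AnnulusEnd) (d : ℝ) : ℝ :=
  -Real.logb p (ω.normAt (x.coord r d))

end

/-- Let `H` be a function on an open edge, in terms of the distance from one end `x`. Then `H` has
slope `m` at the end `x`, in the direction of the edge: near `x` it is affine-linear with slope `m`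
(its value at `x` being defined by continuous extension). -/
def HasSlopeAtEnd (H : ℝ → ℝ) (m : ℤ) : Prop :=
  ∃ c : ℝ, ∀ᶠ d in 𝓝[>] (0 : ℝ), H d = c + m * d

/-- Let `H` be a function on an open edge, in terms of the distance from one end `x`. Then `H` has
slope `m` at the point at distance `d₀` from `x`, in the direction away from `x`. -/
def HasSlopeAt (H : ℝ → ℝ) (d₀ : ℝ) (m : ℤ) : Prop :=
  ∀ᶠ d in 𝓝[>] d₀, H d = H d₀ + m * (d - d₀)

/-- `N_p(r, N₀)`: the smallest positive integer `N` such that `r (n - N₀) > ⌊log_p n⌋` for all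
`n ≥ N`. -/
def rolleN (p : ℕ) (r : ℝ) (N₀ : ℤ) : ℕ :=
  sInf {N : ℕ | 0 < N ∧ ∀ n : ℕ, N ≤ n → r * ((n : ℝ) - N₀) > (⌊Real.logb p n⌋ : ℝ)}

/-- For `r > 0` the integer `rolleN p r N₀` exists. -/
theorem rolleN_isLeast (p : ℕ) [Fact p.Prime] {r : ℝ} (hr : 0 < r) (N₀ : ℤ) :
    IsLeast {N : ℕ | 0 < N ∧ ∀ n : ℕ, N ≤ n → r * ((n : ℝ) - N₀) > (⌊Real.logb p n⌋ : ℝ)}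
      (rolleN p r N₀) := by
  have hp : (1 : ℝ) < p := by exact_mod_cast (Fact.out : p.Prime).one_lt
  have hlp : 0 < Real.log p := Real.log_pos hp
  have hne : {N : ℕ | 0 < N ∧
      ∀ n : ℕ, N ≤ n → r * ((n : ℝ) - N₀) > (⌊Real.logb p n⌋ : ℝ)}.Nonempty := by
    have h1 : ∀ᶠ n : ℕ in atTop, Real.log n ≤ (r / 2 * Real.log p) * n := by
      have := (Real.isLittleO_log_id_atTop.comp_tendsto tendsto_natCast_atTop_atTop).bound
        (show 0 < r / 2 * Real.log p by positivity)
      filter_upwards [this] with n hn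
      simp only [Function.comp_apply, id_eq, Real.norm_eq_abs, Nat.abs_cast] at hn
      exact (le_abs_self _).trans hn
    have h2 : ∀ᶠ n : ℕ in atTop, (2 * |(N₀ : ℝ)| + 1 : ℝ) ≤ n :=
      tendsto_natCast_atTop_atTop.eventually_ge_atTop _
    obtain ⟨N, hN⟩ := eventually_atTop.1 (h1.and h2)
    refine ⟨N + 1, Nat.succ_pos _, fun n hn => ?_⟩
    obtain ⟨ha, hb⟩ := hN n (by omega)
    have hc : Real.logb p n ≤ r / 2 * n := by
      rw [Real.logb, div_le_iff₀ hlp]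
      linarith
    have hd := Int.floor_le (Real.logb p n)
    have he := le_abs_self (N₀ : ℝ)
    nlinarith
  exact ⟨Nat.sInf_mem hne, fun N hN => Nat.sInf_le hN⟩

end

/-! Expand `f` in a parameter of absolute value `p ^ (-d)` at distance `d` from `x`, with
coefficient sizes `b i`. Then `F` is the lower envelope of the lines `-log (b i) + i * d`, and its
slope just beyond a point is the least index `m` attaining the minimum there. Since `G` has slope
`N₀` near `x`, the term of index `N₀` dominates `df` there; letting `d → 0` gives `|i| * b i ≤ |N₀|
* b N₀ ≤ b N₀` for all `i` (`le_of_hasSlopeAtEnd_logGauss`). Put `R = r - a`. If `m ≥ N_p(R, N₀)`,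
then `m > N₀` and `|m| ≥ p ^ (-⌊log_p m⌋) ≥ p ^ (-R * (m - N₀))`. So at distance `R` the term of
index `N₀` is at least as large as that of index `m`, contradicting the choice of `m`. -/

theorem PadicComplex.norm_natCast_ge (p : ℕ) [Fact p.Prime] {n : ℕ} (hn : n ≠ 0) :
    (p : ℝ) ^ (-(⌊Real.logb p n⌋ : ℝ)) ≤ ‖(n : ℂ_[p])‖ := by
  have hp : (1 : ℝ) < p := by exact_mod_cast (Fact.out : p.Prime).one_lt
  have h1 : ‖(n : ℂ_[p])‖ = ‖(n : ℚ_[p])‖ := by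
    rw [← PadicComplex.norm_extends' p (n : ℚ_[p])]
    congr 1
    simp
  have h2 : ((padicValNat p n : ℤ) : ℝ) ≤ ⌊Real.logb p n⌋ := by
    refine Int.cast_le.2 (Int.le_floor.2 ?_)
    rw [Real.le_logb_iff_rpow_le hp (by positivity), Int.cast_natCast, Real.rpow_natCast]
    exact_mod_cast Nat.le_of_dvd (Nat.pos_of_ne_zero hn) pow_padicValNat_dvd
  rw [h1, Padic.norm_eq_zpow_neg_valuation (by exact_mod_cast hn), Padic.valuation_natCast,
    ← Real.rpow_intCast]
  refine Real.rpow_le_rpow_of_exponent_le hp.le ?_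
  push_cast at h2 ⊢
  linarith

/-! ### Gauss norms and dominant terms -/

/-- `-log` of the Gauss norm of radius `q ^ (-d)` attached to the coefficient sizes `b`. -/
noncomputable def logGauss (q : ℝ) (b : ℤ → ℝ) (d : ℝ) : ℝ :=
  -Real.logb q (⨆ i : ℤ, b i * (q ^ (-d)) ^ i)

section

variable {q : ℝ} {b : ℤ → ℝ}

theorem logGauss_eq_of_forall_le (hq : 1 < q) {d : ℝ} {m : ℤ} (hm : 0 < b m)
    (h : ∀ i, b i * (q ^ (-d)) ^ i ≤ b m * (q ^ (-d)) ^ m) :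
    logGauss q b d = -Real.logb q (b m) + m * d := by
  have hq0 : 0 < q := one_pos.trans hq
  have hs : (⨆ i : ℤ, b i * (q ^ (-d)) ^ i) = b m * (q ^ (-d)) ^ m :=
    le_antisymm (ciSup_le h) (le_ciSup (f := fun i : ℤ => b i * (q ^ (-d)) ^ i)
      ⟨_, by rintro _ ⟨i, rfl⟩; exact h i⟩ m)
  rw [logGauss, hs, ← Real.rpow_intCast, ← Real.rpow_mul hq0.le, Real.logb_mul hm.ne' (by positivity),
    Real.logb_rpow hq0 hq.ne']
  ring

theorem exists_least_dominant (hq : 1 < q) {k : ℤ} (hk : 0 < b k)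
    {d : ℝ} (hd : Tendsto (fun i : ℤ => b i * (q ^ (-d)) ^ i) cofinite (𝓝 0)) :
    ∃ m, 0 < b m ∧ (∀ i, b i * (q ^ (-d)) ^ i ≤ b m * (q ^ (-d)) ^ m) ∧
      ∀ i < m, b i * (q ^ (-d)) ^ i < b m * (q ^ (-d)) ^ m := by
  have hq0 : 0 < q := one_pos.trans hq
  have hτ : 0 < q ^ (-d) := by positivity
  set T : ℤ → ℝ := fun i => b i * (q ^ (-d)) ^ i with hT
  -- Terms tend to zero, so only finitely many reach a given positive one; both the maximum and its
  -- least index exist.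
  have hfin (j : ℤ) (hj : 0 < b j) : {i | T j ≤ T i}.Finite := by
    have := hd.eventually_lt_const (show 0 < T j by positivity)
    simpa only [Filter.eventually_cofinite, not_lt] using this
  obtain ⟨j, hj, hjmax⟩ := (hfin k hk).exists_maximalFor T _ ⟨k, le_refl (T k)⟩
  have hjle (i : ℤ) : T i ≤ T j := by
    by_contra! hi
    exact hi.not_ge (hjmax (le_trans hj hi.le) hi.le)
  have hj0 : 0 < b j := by
    have : 0 < T j := lt_of_lt_of_le (show 0 < T k by positivity) hj
    exact pos_of_mul_pos_left this (by positivity)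
  obtain ⟨m, hm, hmmin⟩ := (hfin j hj0).exists_minimalFor id _ ⟨j, le_refl (T j)⟩
  have hm0 : 0 < b m := by
    have : 0 < T m := lt_of_lt_of_le (show 0 < T j by positivity) hm
    exact pos_of_mul_pos_left this (by positivity)
  refine ⟨m, hm0, fun i => (hjle i).trans hm, fun i hi => ?_⟩
  by_contra! h
  exact hi.not_ge (hmmin (show T j ≤ T i from le_trans hm h) hi.le)

theorem continuous_gauss_term (hq : 1 < q) (c : ℝ) (i : ℤ) :
    Continuous fun d : ℝ => c * (q ^ (-d)) ^ i := by
  have hq0 : 0 < q := one_pos.trans hq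
  refine continuous_const.mul (Continuous.zpow₀ ?_ i fun d => .inl (by positivity))
  exact (Real.continuous_const_rpow hq0.ne').comp continuous_neg

theorem gauss_term_le_iff (hq : 1 < q) (d : ℝ) (i m : ℤ) :
    b i * (q ^ (-d)) ^ i ≤ b m * (q ^ (-d)) ^ m ↔
      b i ≤ b m * q ^ (-d * ((m : ℝ) - i)) := by
  have hq0 : 0 < q := one_pos.trans hq
  rw [← Real.rpow_intCast, ← Real.rpow_intCast, ← Real.rpow_mul hq0.le, ← Real.rpow_mul hq0.le,
    mul_sub, Real.rpow_sub hq0, ← mul_div_assoc, le_div_iff₀ (by positivity)]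

/-- Increasing `d` favours small indices, so indices above `m` stay dominated. An index below `m`
dominated at `d₁` is dominated at every smaller `d`; the finitely many others are handled by
continuity and strictness at `d₀`. -/
theorem eventually_dominant (hq : 1 < q) {d₀ d₁ : ℝ} (h01 : d₀ < d₁)
    (hd : Tendsto (fun i : ℤ => b i * (q ^ (-d₁)) ^ i) cofinite (𝓝 0)) {m : ℤ} (hm : 0 < b m)
    (hle : ∀ i, b i * (q ^ (-d₀)) ^ i ≤ b m * (q ^ (-d₀)) ^ m)
    (hlt : ∀ i < m, b i * (q ^ (-d₀)) ^ i < b m * (q ^ (-d₀)) ^ m) :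
    ∀ᶠ d in 𝓝[>] d₀, ∀ i, b i * (q ^ (-d)) ^ i ≤ b m * (q ^ (-d)) ^ m := by
  have hq0 : 0 < q := one_pos.trans hq
  have hfin : {i : ℤ | ¬ b i * (q ^ (-d₁)) ^ i < b m * (q ^ (-d₁)) ^ m}.Finite :=
    Filter.eventually_cofinite.1 (hd.eventually_lt_const (by positivity))
  have hnear : ∀ᶠ d in 𝓝[>] d₀, ∀ i ∈ {i : ℤ | ¬ b i * (q ^ (-d₁)) ^ i < b m * (q ^ (-d₁)) ^ m},
      i < m → b i * (q ^ (-d)) ^ i < b m * (q ^ (-d)) ^ m := by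
    rw [hfin.eventually_all]
    intro i _
    by_cases him : i < m
    · refine Filter.Eventually.mono ?_ fun d hd _ => hd
      exact eventually_nhdsWithin_of_eventually_nhds
        ((continuous_gauss_term hq _ _).continuousAt.eventually_lt
          (continuous_gauss_term hq _ _).continuousAt (hlt i him))
    · exact .of_forall fun _ h => absurd h him
  filter_upwards [hnear, Ioo_mem_nhdsGT h01] with d hd hd' i
  rcases lt_or_ge i m with him | him
  · have him' : (i : ℝ) < m := by exact_mod_cast him
    by_cases hi : b i * (q ^ (-d₁)) ^ i < b m * (q ^ (-d₁)) ^ m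
    · rw [gauss_term_le_iff hq]
      refine ((gauss_term_le_iff hq _ _ _).1 hi.le).trans ?_
      gcongr
      · exact hq.le
      · exact hd'.2.le
    · exact (hd i hi him).le
  · have him' : (m : ℝ) ≤ i := by exact_mod_cast him
    rw [gauss_term_le_iff hq]
    refine ((gauss_term_le_iff hq _ _ _).1 (hle i)).trans ?_
    refine mul_le_mul_of_nonneg_left ?_ hm.le
    refine Real.rpow_le_rpow_of_exponent_le hq.le ?_
    nlinarith [hd'.1]

theorem le_of_hasSlopeAtEnd_logGauss (hq : 1 < q) {k : ℤ} (hk : 0 < b k)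
    {r : ℝ} (hr : 0 < r)
    (hd : ∀ d ∈ Set.Ioo 0 r, Tendsto (fun i : ℤ => b i * (q ^ (-d)) ^ i) cofinite (𝓝 0))
    {N : ℤ} (hN : HasSlopeAtEnd (logGauss q b) N) (i : ℤ) : b i ≤ b N := by
  have hq0 : 0 < q := one_pos.trans hq
  obtain ⟨c, hc⟩ := hN
  obtain ⟨ε, hε, hcε⟩ := mem_nhdsGT_iff_exists_Ioo_subset.1 hc
  have hε0 : (0 : ℝ) < ε := hε
  have key : ∀ d ∈ Set.Ioo 0 (min ε r), ∀ i, b i * (q ^ (-d)) ^ i ≤ b N * (q ^ (-d)) ^ N := by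
    intro d hdm
    have hdε : d < ε := hdm.2.trans_le (min_le_left _ _)
    have hdr : d < r := hdm.2.trans_le (min_le_right _ _)
    obtain ⟨d₁, hd1, hd1r⟩ := exists_between hdr
    obtain ⟨m, hm, hle, hlt⟩ := exists_least_dominant hq hk (hd d ⟨hdm.1, hdr⟩)
    have hev := eventually_dominant hq hd1 (hd d₁ ⟨hdm.1.trans hd1, hd1r⟩) hm hle hlt
    -- The same index `m` dominates at `d` and at a nearby `e > d`, so two values of the affine
    -- function force `m = N`.
    obtain ⟨e, he, hde, heε⟩ := (hev.and (Ioo_mem_nhdsGT hdε)).exists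
    have h1 := logGauss_eq_of_forall_le hq hm hle
    have h2 := logGauss_eq_of_forall_le hq hm he
    have h3 : logGauss q b d = c + N * d := hcε ⟨hdm.1, hdε⟩
    have h4 : logGauss q b e = c + N * e := hcε ⟨hdm.1.trans hde, heε⟩
    have h5 : ((m : ℝ) - N) * (e - d) = 0 := by linarith
    have h6 : (m : ℝ) = N := by
      rcases mul_eq_zero.1 h5 with h | h <;> linarith
    obtain rfl : m = N := by exact_mod_cast h6
    exact hle
  have hlim (c : ℝ) (j : ℤ) : Tendsto (fun d : ℝ => c * (q ^ (-d)) ^ j) (𝓝[>] 0) (𝓝 c) := by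
    have h := (continuous_gauss_term hq c j).tendsto 0
    simp only [neg_zero, Real.rpow_zero, one_zpow, mul_one] at h
    exact h.mono_left nhdsWithin_le_nhds
  -- Convergence is not assumed at `d = 0`, so the inequality is passed to the limit term by term.
  refine le_of_tendsto_of_tendsto (hlim (b i) i) (hlim (b N) N) ?_
  filter_upwards [Ioo_mem_nhdsGT (lt_min hε0 hr)] with d hdm using key d hdm i

end

/-! ### Reduction of both ends to one parameter -/

section

variable {p : ℕ} [Fact p.Prime] {r : ℝ}

/-- The absolute values of the Laurent coefficients of `f` with respect to a parameter that has
absolute value tending to `1` at the end `x`. -/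
noncomputable def AnnulusFunction.sizeAt (f : AnnulusFunction p r) (x : AnnulusEnd) (i : ℤ) : ℝ :=
  match x with
  | .outer => ‖f.coeff i‖
  | .inner => ‖f.coeff (-i)‖ * ((p : ℝ) ^ (-r)) ^ (-i)

/-- The Laurent exponent, in terms of `t`, of the `i`-th power of a parameter at the end `x`. -/
def AnnulusEnd.index (x : AnnulusEnd) : ℤ ≃ ℤ :=
  match x with
  | .outer => Equiv.refl ℤ
  | .inner => Equiv.neg ℤ

namespace AnnulusFunction

theorem sizeAt_nonneg (f : AnnulusFunction p r) (x : AnnulusEnd) (i : ℤ) : 0 ≤ f.sizeAt x i := by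
  cases x <;> simp only [sizeAt] <;> positivity

theorem sizeAt_mul (f : AnnulusFunction p r) (x : AnnulusEnd) (d : ℝ) (i : ℤ) :
    f.sizeAt x i * ((p : ℝ) ^ (-d)) ^ i =
      ‖f.coeff (x.index i)‖ * ((p : ℝ) ^ (-x.coord r d)) ^ x.index i := by
  have hp : (0 : ℝ) < p := by exact_mod_cast (Fact.out : p.Prime).pos
  cases x with
  | outer => rfl
  | inner =>
    have h : (p : ℝ) ^ (-(r - d)) = (p : ℝ) ^ (-r) * ((p : ℝ) ^ (-d))⁻¹ := by
      rw [← Real.rpow_neg hp.le, ← Real.rpow_add hp]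
      ring_nf
    simp only [sizeAt, AnnulusEnd.index, AnnulusEnd.coord, Equiv.neg_apply]
    rw [h, mul_zpow, inv_zpow, zpow_neg ((p : ℝ) ^ (-d)), inv_inv, mul_assoc]

theorem trop_eq_logGauss (f : AnnulusFunction p r) (x : AnnulusEnd) :
    f.trop x = logGauss p (f.sizeAt x) := by
  funext d
  simp only [trop, absAt, logGauss, sizeAt_mul]
  rw [x.index.iSup_comp (g := fun i : ℤ => ‖f.coeff i‖ * ((p : ℝ) ^ (-x.coord r d)) ^ i)]

theorem tendsto_sizeAt (f : AnnulusFunction p r) (x : AnnulusEnd) {d : ℝ}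
    (hd : d ∈ Set.Ioo 0 r) :
    Tendsto (fun i : ℤ => f.sizeAt x i * ((p : ℝ) ^ (-d)) ^ i) cofinite (𝓝 0) := by
  have hx : x.coord r d ∈ Set.Ioo 0 r := by
    cases x with
    | outer => exact hd
    | inner => exact ⟨sub_pos.2 hd.2, sub_lt_self r hd.1⟩
  simp only [sizeAt_mul]
  exact (f.tendsto_zero _ hx).comp x.index.injective.tendsto_cofinite

theorem sizeAt_d (f : AnnulusFunction p r) (x : AnnulusEnd) (i : ℤ) :
    f.d.h.sizeAt x i = ‖(i : ℂ_[p])‖ * f.sizeAt x i := by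
  cases x <;> simp [sizeAt, d, mul_assoc]

theorem exists_sizeAt_pos (f : AnnulusFunction p r) (x : AnnulusEnd) (hf : f ≠ 0) :
    ∃ i, 0 < f.sizeAt x i := by
  have hp : (0 : ℝ) < p := by exact_mod_cast (Fact.out : p.Prime).pos
  obtain ⟨i, hi⟩ : ∃ i, f.coeff i ≠ 0 := by
    by_contra! h
    exact hf (AnnulusFunction.ext (funext h))
  cases x with
  | outer => exact ⟨i, norm_pos_iff.2 hi⟩
  | inner =>
    refine ⟨-i, ?_⟩
    simp only [sizeAt, neg_neg]
    have := norm_pos_iff.2 hi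
    positivity

end AnnulusFunction

end

theorem propositionp (p : ℕ) [Fact p.Prime] (r : ℝ) (hr : 0 < r)
    (ω : AnnulusForm p r) (hω : ω ≠ 0)
    (f : AnnulusFunction p r) (hf : ω = f.d)
    (x : AnnulusEnd) (N₀ : ℤ) (hN₀ : HasSlopeAtEnd (ω.trop x) N₀)
    (a : ℝ) (ha : a ∈ Set.Ioo 0 r) :
    ∃ m : ℤ, HasSlopeAt (f.trop x) (r - a) m ∧ m ≤ (rolleN p (r - a) N₀ : ℤ) := by
  have hp : (1 : ℝ) < p := by exact_mod_cast (Fact.out : p.Prime).one_lt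
  have hp0 : (0 : ℝ) < p := one_pos.trans hp
  have hR : r - a ∈ Set.Ioo 0 r := ⟨sub_pos.2 ha.2, sub_lt_self r ha.1⟩
  subst hf
  set R := r - a
  set b := f.sizeAt x
  have hb0 : ∀ i, 0 ≤ b i := f.sizeAt_nonneg x
  obtain ⟨k, hk⟩ := f.d.h.exists_sizeAt_pos x fun h => hω (AnnulusForm.ext h)
  have hbk : 0 < b k := by
    rw [f.sizeAt_d] at hk
    exact pos_of_mul_pos_right hk (norm_nonneg _)
  have hgN : ∀ i : ℤ, ‖(i : ℂ_[p])‖ * b i ≤ b N₀ := by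
    have hG : HasSlopeAtEnd (logGauss p (f.d.h.sizeAt x)) N₀ := by
      rw [← AnnulusFunction.trop_eq_logGauss]
      exact hN₀
    intro i
    have h := le_of_hasSlopeAtEnd_logGauss hp hk hr
      (fun d hd => f.d.h.tendsto_sizeAt x hd) hG i
    rw [f.sizeAt_d, f.sizeAt_d] at h
    exact h.trans (mul_le_of_le_one_left (hb0 _) (IsUltrametricDist.norm_intCast_le_one ℂ_[p] N₀))
  obtain ⟨m, hm, hle, hlt⟩ := exists_least_dominant hp hbk (f.tendsto_sizeAt x hR)
  refine ⟨m, ?_, ?_⟩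
  · obtain ⟨d₁, hd1, hd1r⟩ := exists_between hR.2
    rw [f.trop_eq_logGauss]
    filter_upwards [eventually_dominant hp hd1
      (f.tendsto_sizeAt x ⟨hR.1.trans hd1, hd1r⟩) hm hle hlt] with d hd
    rw [logGauss_eq_of_forall_le hp hm hd, logGauss_eq_of_forall_le hp hm hle]
    ring
  · by_contra! hlarge
    obtain ⟨n, rfl⟩ : ∃ n : ℕ, m = n := Int.eq_ofNat_of_zero_le (by omega)
    have hn : rolleN p R N₀ ≤ n := by omega
    have hn0 : n ≠ 0 := by omega
    have hroll := (rolleN_isLeast p hR.1 N₀).1.2 n hn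
    have hn1 : (1 : ℝ) ≤ n := by exact_mod_cast Nat.one_le_iff_ne_zero.2 hn0
    have hfl : (0 : ℝ) ≤ ⌊Real.logb p n⌋ := by
      exact_mod_cast Int.floor_nonneg.2 (Real.logb_nonneg hp hn1)
    have hNn : (N₀ : ℝ) < n := by
      have := pos_of_mul_pos_right (hfl.trans_lt hroll) hR.1.le
      linarith
    -- Minimality of the dominant index makes this strict, so a weak reverse inequality suffices.
    have h1 := hlt N₀ (by exact_mod_cast hNn)
    refine h1.not_ge ((gauss_term_le_iff hp _ _ _).2 ?_)
    have h2 : (p : ℝ) ^ (R * ((N₀ : ℝ) - n)) ≤ ‖(n : ℂ_[p])‖ := by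
      refine (Real.rpow_le_rpow_of_exponent_le hp.le ?_).trans
        (PadicComplex.norm_natCast_ge p hn0)
      linarith
    have h3 : (p : ℝ) ^ (R * ((N₀ : ℝ) - n)) * b n ≤ b N₀ := by
      refine (mul_le_mul_of_nonneg_right h2 hm.le).trans ?_
      simpa using hgN n
    rw [neg_mul, Real.rpow_neg hp0.le, Int.cast_natCast, ← div_eq_mul_inv,
      le_div_iff₀ (by positivity), mul_comm]
    exact h3
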